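/- Let $d\ge 2$. Let $B\subset\mathbb{R}^d$ and $\Omega^*\subset\mathbb{R}^d$ be bounded open sets with Lipschitz boundaries $\partial B$ and $\Gamma^*=\partial\Omega^*$, such that $\overline{B}\subset\Omega^*$; let $\nu$ be the outward unit normal to $\Omega^*$ on $\Gamma^*$ and $\mathrm{d}s$ the surface measure ($(d-1)$-dimensional Hausdorff measure). Let $F(\cdot\,;\Gamma)$ assign a real-valued function to each boundary $\Gamma$, with $F(\cdot\,;\Gamma^*)\in L^2(\Gamma^*)$. Put $$H^1_{\partial B,0}=\{\varphi\in H^1(\Omega^*\setminus\overline{B};\mathbb{R}^d) : \varphi=0 \text{ on } \partial B \text{ in the sense of traces}\}.$$ Call $\Omega^*$ a stationary solution of the abstract moving boundary problem $V_n=F(\cdot\,;\Gamma)$ if $F(x;\Gamma^*)=0$ for almost every $x\in\Gamma^*$. For $\varepsilon>0$, the $\varepsilon$-regularized (comoving mesh) problem is $$-\Delta w=0 \text{ in } \Omega\setminus\overline{B},\qquad w=0 \text{ on } \partial B,\qquad \varepsilon\nabla w\cdot\nu+w=F(\cdot\,;\Gamma)\,\nu \text{ on } \Gamma,\qquad V_n=w\cdot\nu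 \text{ on } \Gamma.$$ Call $\Omega^*$ a stationary solution of the $\varepsilon$-regularized problem if the weak problem of finding $w\in H^1_{\partial B,0}$ with $$\varepsilon\int_{\Omega^*\setminus\overline{B}}\nabla w:\nabla\varphi\,\mathrm{d}x+\int_{\Gamma^*}w\cdot\varphi\,\mathrm{d}s=\int_{\Gamma^*}F(\cdot\,;\Gamma^*)\,\nu\cdot\varphi\,\mathrm{d}s\qquad\text{for all }\varphi\in H^1_{\partial B,0}$$ has a solution, and every solution $w$ satisfies $w\cdot\nu=0$ almost everywhere on $\Gamma^*$. Then the following three conditions are equivalent: (i) $\Omega^*$ is a stationary solution of the abstract moving boundary problem; (ii) $\Omega^*$ is a stationary solution of the $\varepsilon$-regularized problem for every $\varepsilon>0$; (iii) $\Omega^*$ is a stationary solution of the $\varepsilon$-regularized problem for some $\varepsilon>0$. -/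

import Mathlib

open MeasureTheory Set Filter Topology
open scoped NNReal ENNReal ContDiff InnerProductSpace

namespace CMM

/-- The Euclidean space `ℝ^d`. -/
abbrev E (d : ℕ) : Type := EuclideanSpace ℝ (Fin d)

/-- `Ω` has Lipschitz boundary: near each boundary point there are a unit vector `e` and a Lipschitz
function `h` on the hyperplane `e^⊥` such that `Ω` is, locally, the set of the points lying
strictly above the graph of `h` in the direction `e`. (For open `Ω` the boundary is then locally
the graph of `h`.) -/
def HasLipschitzBoundary {d : ℕ} (Ω : Set (E d)) : Prop :=
  ∀ x ∈ frontier Ω, ∃ e : E d, ‖e‖ = 1 ∧ ∃ (h : (ℝ ∙ e)ᗮ → ℝ) (K : ℝ≥0), LipschitzWith K h ∧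
    ∀ᶠ y in 𝓝 x, (y ∈ Ω ↔ h ((ℝ ∙ e)ᗮ.orthogonalProjectionOnto y) < ⟪e, y⟫_ℝ)

/-- `n` is the outward unit normal of `Ω` at `x`: up to a cone of arbitrarily small opening around
the hyperplane `x + n^⊥`, near `x` the set `Ω` is the half-space `{y | ⟪n, y - x⟫ < 0}`.
At a boundary point of a Lipschitz domain this says that the local graph function is differentiable
there and that `n` is the usual unit normal of the graph, pointing out of `Ω`. -/
def IsOutwardUnitNormal {d : ℕ} (Ω : Set (E d)) (x n : E d) : Prop :=
  ‖n‖ = 1 ∧ ∀ δ : ℝ, 0 < δ → ∀ᶠ y in 𝓝 x,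
    (⟪n, y - x⟫_ℝ < -(δ * ‖y - x‖) → y ∈ Ω) ∧ (δ * ‖y - x‖ < ⟪n, y - x⟫_ℝ → y ∉ Ω)

open Classical in
/-- The outward unit normal field `ν` of `Ω`; it is `0` at the points where there is no normal. -/
noncomputable def outwardNormal {d : ℕ} (Ω : Set (E d)) (x : E d) : E d :=
  if h : ∃ n, IsOutwardUnitNormal Ω x n then h.choose else 0

/-- The surface measure `ds` on a subset `S` of `ℝ^d`: the `(d - 1)`-dimensional Hausdorff measure,
normalised so as to agree with Lebesgue measure on hyperplanes, restricted to `S`. -/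
noncomputable def surfaceMeasure {d : ℕ} (S : Set (E d)) : Measure (E d) :=
  (μHE[d - 1] : Measure (E d)).restrict S

/-- The `i`-th partial derivative of a vector field on `ℝ^d` (used for smooth fields). -/
noncomputable def partialDeriv {d : ℕ} (i : Fin d) (u : E d → E d) (x : E d) : E d :=
  fderiv ℝ u x (EuclideanSpace.single i (1 : ℝ))

/-- `g` is the weak partial derivative `∂ᵢ u` in `D`: `∫_D u ∂ᵢψ dx = - ∫_D g ψ dx` for all test
functions `ψ ∈ C_c^∞(D)`. -/
def HasWeakPartialDeriv {d : ℕ} (D : Set (E d)) (i : Fin d) (u g : E d → E d) : Prop :=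
  ∀ ψ : E d → ℝ, ContDiff ℝ ∞ ψ → HasCompactSupport ψ → tsupport ψ ⊆ D →
    ∫ x in D, fderiv ℝ ψ x (EuclideanSpace.single i (1 : ℝ)) • u x = -∫ x in D, ψ x • g x

/-- An element of `H^1(D; ℝ^d)`, given as a square integrable vector field on `D` together with its
square integrable weak partial derivatives. -/
structure SobolevH1 {d : ℕ} (D : Set (E d)) where
  /-- the vector field -/
  toFun : E d → E d
  /-- its weak partial derivatives -/
  grad : Fin d → E d → E d
  memLp : MemLp toFun 2 (volume.restrict D)
  memLp_grad : ∀ i, MemLp (grad i) 2 (volume.restrict D)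
  hasWeakPartialDeriv : ∀ i, HasWeakPartialDeriv D i toFun (grad i)

/-- `g ∈ L²(S; ℝ^d)` is the trace of `u ∈ H^1(D; ℝ^d)` on the part `S` of the boundary of `D`: the
pair `(u, g)` is the limit in `H^1(D) × L²(S)` of pairs `(φ, φ|_S)` with `φ` smooth up to the
boundary. (The graph of the trace operator is the closure of such pairs.) -/
def HasTrace {d : ℕ} {D : Set (E d)} (u : SobolevH1 D) (S : Set (E d)) (g : E d → E d) : Prop :=
  MemLp g 2 (surfaceMeasure S) ∧ ∃ φ : ℕ → E d → E d, (∀ k, ContDiff ℝ ∞ (φ k)) ∧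
    Tendsto (fun k => eLpNorm (φ k - u.toFun) 2 (volume.restrict D)) atTop (𝓝 0) ∧
    (∀ i, Tendsto (fun k => eLpNorm (partialDeriv i (φ k) - u.grad i) 2 (volume.restrict D))
      atTop (𝓝 0)) ∧
    Tendsto (fun k => eLpNorm (φ k - g) 2 (surfaceMeasure S)) atTop (𝓝 0)

/-- The field `w ∈ H^1(Ω \ closure B; ℝ^d)`, with trace `tw` on `Γ = ∂Ω`, is a weak solution of
`-Δw = 0` in `Ω \ closure B`, `w = 0` on `∂B`, `ε ∇w · ν + w = F(·; Γ) ν` on `Γ`: it vanishes on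
`∂B`, and
`ε ∫ ∇w : ∇φ dx + ∫_Γ w · φ ds = ∫_Γ F(·; Γ) ν · φ ds`
for all `φ ∈ H^1(Ω \ closure B; ℝ^d)` vanishing on `∂B` (with trace `tφ` on `Γ`). -/
def IsWeakSolution {d : ℕ} (F : Set (E d) → E d → ℝ) (B Ω : Set (E d)) (ε : ℝ)
    (w : SobolevH1 (Ω \ closure B)) (tw : E d → E d) : Prop :=
  HasTrace w (frontier B) 0 ∧ HasTrace w (frontier Ω) tw ∧
    ∀ (φ : SobolevH1 (Ω \ closure B)) (tφ : E d → E d),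
      HasTrace φ (frontier B) 0 → HasTrace φ (frontier Ω) tφ →
        ε * (∫ x in Ω \ closure B, ∑ i, ⟪w.grad i x, φ.grad i x⟫_ℝ)
            + (∫ x, ⟪tw x, tφ x⟫_ℝ ∂(surfaceMeasure (frontier Ω)))
          = ∫ x, F (frontier Ω) x * ⟪outwardNormal Ω x, tφ x⟫_ℝ ∂(surfaceMeasure (frontier Ω))

/-- `Ω` is a stationary solution of the abstract moving boundary problem `V_n = F(·; Γ)`. -/
def IsStationary {d : ℕ} (F : Set (E d) → E d → ℝ) (Ω : Set (E d)) : Prop :=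
  ∀ᵐ x ∂(surfaceMeasure (frontier Ω)), F (frontier Ω) x = 0

/-- `Ω` is a stationary solution of the `ε`-regularized moving boundary problem: the Robin problem
has a weak solution `w`, and the weak solution satisfies `w · ν = 0` on `Γ = ∂Ω`. -/
def IsStationaryRegularized {d : ℕ} (F : Set (E d) → E d → ℝ) (B Ω : Set (E d)) (ε : ℝ) : Prop :=
  (∃ w tw, IsWeakSolution F B Ω ε w tw) ∧
    ∀ w tw, IsWeakSolution F B Ω ε w tw →
      ∀ᵐ x ∂(surfaceMeasure (frontier Ω)), ⟪tw x, outwardNormal Ω x⟫_ℝ = 0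

end CMM

/-!
The implication from stationarity of the regularized problem for some `ε` back to `F = 0` is the
substantial one. Write `Γ = ∂Ω`.

Testing the weak problem with its own solution `w` gives the energy identity
`ε ∫ |∇w|² + ∫_Γ |w|² = ∫_Γ F ν · w`. If the right-hand side vanishes, then `w = 0` on `Γ` and
`∇w = 0` (`IsWeakSolution.eq_zero`). The right-hand side vanishes in both situations of interest:
when `F = 0` on `Γ`, and when `w · ν = 0` on `Γ`.

* If `F = 0` almost everywhere on `Γ`, then `w = 0` is a weak solution for every `ε > 0`, and every
  weak solution vanishes on `Γ` by the energy identity.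
* If a weak solution `w` satisfies `w · ν = 0` on `Γ`, the energy identity makes the left-hand side
  of the weak problem vanish for every test field, so that `∫_Γ F ν · φ = 0` for all admissible `φ`.
  Since `closure B` and `Γ` are disjoint, smooth fields with compact support away from `closure B`
  are admissible; they are rich enough to force `F ν = 0` almost everywhere on `Γ`
  (`ae_eq_zero_of_integral_normal_eq_zero`), and `|ν| = 1` almost everywhere gives `F = 0`.

The last step needs the surface measure of `Γ` to be finite and `ν` to be measurable and of unit
length almost everywhere (`surfaceMeasure_frontier`). By compactness this is local. Locally `Γ` lies
on a Lipschitz graph `{h(Py) = ⟪e, y⟫}`, the image of a hyperplane under a Lipschitz map, which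
gives finiteness; by Rademacher's theorem `h` is differentiable outside a null set, whose image in
`Γ` is again null, and at the remaining points the normal is the normalised gradient of
`y ↦ h(Py) - ⟪e, y⟫`.
-/

namespace CMM

/-! ### Hausdorff measure of Lipschitz images -/

theorem _root_.LipschitzWith.euclideanHausdorffMeasure_image_le {X Y : Type*}
    [EMetricSpace X] [MeasurableSpace X] [BorelSpace X]
    [EMetricSpace Y] [MeasurableSpace Y] [BorelSpace Y]
    {K : ℝ≥0} {f : X → Y} (hf : LipschitzWith K f) (n : ℕ) (s : Set X) :
    (μHE[n] : Measure Y) (f '' s) ≤ (K : ℝ≥0∞) ^ (n : ℝ) * (μHE[n] : Measure X) s := by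
  simp only [Measure.euclideanHausdorffMeasure_def, Measure.smul_apply, ENNReal.smul_def,
    smul_eq_mul]
  calc _ ≤ _ * ((K : ℝ≥0∞) ^ (n : ℝ) * μH[n] s) := by
        gcongr
        exact hf.hausdorffMeasure_image_le (by positivity) s
    _ = _ := by ring

/-! ### The outward unit normal -/

/-- If `n ≠ n'` were both outward unit normals, the direction `n' - n` would point strictly into `Ω`
according to `n` and strictly out of `Ω` according to `n'`. -/
theorem IsOutwardUnitNormal.unique {d : ℕ} {Ω : Set (E d)} {x n n' : E d}
    (h : IsOutwardUnitNormal Ω x n) (h' : IsOutwardUnitNormal Ω x n') : n = n' := by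
  by_contra hne
  have hlt : ⟪n, n'⟫_ℝ < 1 := inner_lt_one_iff_real_of_norm_eq_one h.1 h'.1 |>.2 hne
  set v := n' - n with hv
  have hv0 : 0 < ‖v‖ := norm_pos_iff.2 (sub_ne_zero.2 (Ne.symm hne))
  have h1 : ⟪n, v⟫_ℝ = -(1 - ⟪n, n'⟫_ℝ) := by
    rw [hv, inner_sub_right, real_inner_self_eq_norm_sq, h.1]; ring
  have h2 : ⟪n', v⟫_ℝ = 1 - ⟪n, n'⟫_ℝ := by
    rw [hv, inner_sub_right, real_inner_self_eq_norm_sq, h'.1, real_inner_comm]; ring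
  set c := 1 - ⟪n, n'⟫_ℝ with hc
  have hc0 : 0 < c := by linarith
  -- this `δ` puts the direction `v` inside both cones: `δ * ‖v‖ = c / 2 < c`
  set δ := c / (2 * ‖v‖) with hδ
  have hδv : δ * ‖v‖ = c / 2 := by rw [hδ]; field_simp
  have hlim : Tendsto (fun t : ℝ => x + t • v) (𝓝[>] 0) (𝓝 x) := by
    have : Tendsto (fun t : ℝ => x + t • v) (𝓝 0) (𝓝 (x + (0 : ℝ) • v)) :=
      Continuous.tendsto (by fun_prop) 0
    simpa using this.mono_left nhdsWithin_le_nhds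
  have hδ0 : 0 < δ := by positivity
  obtain ⟨t, ⟨ht1, ht2⟩, ht0⟩ := ((hlim.eventually ((h.2 δ hδ0).and (h'.2 δ hδ0))).and
    self_mem_nhdsWithin).exists
  have ht0 : 0 < t := ht0
  simp only [add_sub_cancel_left, inner_smul_right, norm_smul, Real.norm_eq_abs,
    abs_of_pos ht0, h1, h2] at ht1 ht2
  have key : δ * (t * ‖v‖) = t * (c / 2) := by rw [← hδv]; ring
  have htc : 0 < t * c := by positivity
  rw [key] at ht1 ht2
  exact ht2.2 (by linarith) (ht1.1 (by linarith))

theorem IsOutwardUnitNormal.outwardNormal_eq {d : ℕ} {Ω : Set (E d)} {x n : E d}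
    (h : IsOutwardUnitNormal Ω x n) : outwardNormal Ω x = n := by
  have hex : ∃ n, IsOutwardUnitNormal Ω x n := ⟨n, h⟩
  rw [outwardNormal, dif_pos hex]
  exact hex.choose_spec.unique h

/-- At a zero where its gradient does not vanish, a local defining function of `Ω` yields the
outward unit normal as its normalised gradient. -/
theorem isOutwardUnitNormal_of_hasGradientAt {d : ℕ} {Ω : Set (E d)} {x m : E d} {G : E d → ℝ}
    (hG : HasGradientAt G m x) (hm : m ≠ 0) (hx : G x = 0)
    (hΩ : ∀ᶠ y in 𝓝 x, (y ∈ Ω ↔ G y < 0)) :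
    IsOutwardUnitNormal Ω x (‖m‖⁻¹ • m) := by
  have hm0 : 0 < ‖m‖ := norm_pos_iff.2 hm
  refine ⟨by rw [norm_smul, norm_inv, norm_norm, inv_mul_cancel₀ hm0.ne'], fun δ hδ => ?_⟩
  have hlo := hG.hasFDerivAt.isLittleO.def (c := δ * ‖m‖) (by positivity)
  filter_upwards [hlo, hΩ] with y hy hyΩ
  simp only [hx, sub_zero, InnerProductSpace.toDual_apply_apply, Real.norm_eq_abs] at hy
  rw [abs_le] at hy
  have hin : ⟪‖m‖⁻¹ • m, y - x⟫_ℝ * ‖m‖ = ⟪m, y - x⟫_ℝ := by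
    rw [real_inner_smul_left]; field_simp
  constructor
  · intro h
    have := mul_lt_mul_of_pos_right h hm0
    rw [hyΩ]; nlinarith
  · intro h
    have := mul_lt_mul_of_pos_right h hm0
    rw [hyΩ]; nlinarith

/-! ### Lipschitz graphs and the surface measure -/

/-- `y ↦ h(Py) - ⟪e, y⟫`, where `P` is the orthogonal projection onto `e^⊥`: the points where this
function is negative are those above the graph of `h` in the direction `e`. -/
noncomputable def graphFun {d : ℕ} (e : E d) (h : (ℝ ∙ e)ᗮ → ℝ) (y : E d) : ℝ :=
  h ((ℝ ∙ e)ᗮ.orthogonalProjectionOnto y) - ⟪e, y⟫_ℝ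

theorem graphFun_continuous {d : ℕ} (e : E d) {h : (ℝ ∙ e)ᗮ → ℝ} (hh : Continuous h) :
    Continuous (graphFun e h) := by
  unfold graphFun; fun_prop

theorem graphFun_differentiableAt {d : ℕ} {e : E d} {h : (ℝ ∙ e)ᗮ → ℝ} {y : E d}
    (hh : DifferentiableAt ℝ h ((ℝ ∙ e)ᗮ.orthogonalProjectionOnto y)) :
    DifferentiableAt ℝ (graphFun e h) y := by
  unfold graphFun
  exact (hh.comp y ((ℝ ∙ e)ᗮ.orthogonalProjectionOnto.differentiableAt)).sub
    (innerSL ℝ e).differentiableAt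

/-- The function decreases with unit speed in the direction `e`. -/
theorem gradient_graphFun_ne_zero {d : ℕ} {e : E d} (he : ‖e‖ = 1) {h : (ℝ ∙ e)ᗮ → ℝ} {y : E d}
    (hd : DifferentiableAt ℝ (graphFun e h) y) : gradient (graphFun e h) y ≠ 0 := by
  intro h0
  have h1 : HasFDerivAt (graphFun e h) (0 : E d →L[ℝ] ℝ) y := by
    have := hd.hasGradientAt.hasFDerivAt
    rwa [h0, map_zero] at this
  have h2 : HasDerivAt (fun t : ℝ => graphFun e h (y + t • e)) 0 0 := by
    have hl : HasDerivAt (fun t : ℝ => y + t • e) e 0 := by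
      simpa using ((hasDerivAt_id (0 : ℝ)).smul_const e).const_add y
    have := HasFDerivAt.comp_hasDerivAt (f := fun t : ℝ => y + t • e) (0 : ℝ)
      (by simpa using h1) hl
    exact this
  have h3 : (fun t : ℝ => graphFun e h (y + t • e)) = fun t => graphFun e h y - t := by
    funext t
    have hP : (ℝ ∙ e)ᗮ.orthogonalProjectionOnto e = 0 :=
      Submodule.orthogonalProjectionOnto_orthogonalComplement_singleton_eq_zero e
    simp only [graphFun, map_add, map_smul, hP, smul_zero, add_zero, inner_add_right,
      inner_smul_right, real_inner_self_eq_norm_sq, he]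
    ring
  rw [h3] at h2
  have h4 : HasDerivAt (fun t : ℝ => graphFun e h y - t) (-1) 0 := by
    simpa using (hasDerivAt_id (0 : ℝ)).const_sub (graphFun e h y)
  exact absurd (h2.unique h4) (by norm_num)

theorem lipschitzWith_graph {d : ℕ} {e : E d} (he : ‖e‖ = 1) {h : (ℝ ∙ e)ᗮ → ℝ} {K : ℝ≥0}
    (hh : LipschitzWith K h) : LipschitzWith (1 + K) fun z : (ℝ ∙ e)ᗮ => (z : E d) + h z • e := by
  refine LipschitzWith.add (LipschitzWith.subtype_val _)
    (LipschitzWith.of_dist_le_mul fun z z' => ?_)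
  rw [dist_eq_norm, ← sub_smul, norm_smul, he, mul_one, ← dist_eq_norm]
  exact hh.dist_le_mul z z'

theorem eq_graph_of_graphFun_eq_zero {d : ℕ} {e : E d} (he : ‖e‖ = 1) {h : (ℝ ∙ e)ᗮ → ℝ} {y : E d}
    (hy : graphFun e h y = 0) :
    ((ℝ ∙ e)ᗮ.orthogonalProjectionOnto y : E d)
      + h ((ℝ ∙ e)ᗮ.orthogonalProjectionOnto y) • e = y := by
  rw [sub_eq_zero.1 hy]
  have h1 := Submodule.starProjection_add_starProjection_orthogonal (K := ℝ ∙ e) y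
  rw [Submodule.starProjection_unit_singleton ℝ he] at h1
  rw [add_comm]; exact h1

theorem eq_zero_of_mem_frontier_of_locally_lt {X : Type*} [TopologicalSpace X] {Ω : Set X} {x : X}
    {G : X → ℝ} (hG : Continuous G) (hx : x ∈ frontier Ω) (hΩ : ∀ᶠ y in 𝓝 x, (y ∈ Ω ↔ G y < 0)) :
    G x = 0 := by
  rcases lt_trichotomy (G x) 0 with h | h | h
  · refine absurd ?_ hx.2
    rw [mem_interior_iff_mem_nhds]
    filter_upwards [hΩ, hG.continuousAt.eventually_lt_const h] with y hy hy' using hy.2 hy'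
  · exact h
  · have := mem_closure_iff_frequently.1 hx.1
    exfalso
    refine this ?_
    filter_upwards [hΩ, hG.continuousAt.eventually_const_lt h] with y hy hy' hyΩ
    exact lt_asymm hy' (hy.1 hyΩ)

theorem finrank_orthogonal_span_unit {d : ℕ} {e : E d} (he : ‖e‖ = 1) :
    Module.finrank ℝ (ℝ ∙ e)ᗮ = d - 1 := by
  have h := (ℝ ∙ e).finrank_add_finrank_orthogonal
  rw [finrank_span_singleton (by rintro rfl; simp at he), finrank_euclideanSpace_fin] at h
  omega

/-- A Lipschitz boundary piece is contained in a Lipschitz image of a bounded piece of a hyperplane,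
and by Rademacher's theorem the graph function is differentiable off a set whose image in the
boundary is null. -/
theorem exists_mem_nhdsWithin_frontier {d : ℕ} {Ω : Set (E d)} (hΩ : HasLipschitzBoundary Ω)
    {x : E d} (hx : x ∈ frontier Ω) :
    ∃ t ∈ 𝓝[frontier Ω] x, (μHE[d - 1] : Measure (E d)) t ≠ ⊤ ∧
      AEMeasurable (outwardNormal Ω) ((μHE[d - 1] : Measure (E d)).restrict t) ∧
      ∀ᵐ y ∂((μHE[d - 1] : Measure (E d)).restrict t), ‖outwardNormal Ω y‖ = 1 := by
  obtain ⟨e, he, h, K, hh, hev⟩ := hΩ x hx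
  set P := (ℝ ∙ e)ᗮ.orthogonalProjectionOnto with hP
  set G := graphFun e h with hGdef
  have hGc : Continuous G := graphFun_continuous e hh.continuous
  have hev' : ∀ᶠ y in 𝓝 x, (y ∈ Ω ↔ G y < 0) := by
    filter_upwards [hev] with y hy
    rw [hy, hGdef, graphFun, sub_neg]
  obtain ⟨r, hr, hball⟩ := Metric.eventually_nhds_iff_ball.1 hev'.eventually_nhds
  set t := frontier Ω ∩ Metric.ball x r with ht
  have htm : MeasurableSet t :=
    isClosed_frontier.measurableSet.inter Metric.isOpen_ball.measurableSet
  have hG0 : ∀ y ∈ t, G y = 0 := fun y hy =>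
    eq_zero_of_mem_frontier_of_locally_lt hGc hy.1 (hball y hy.2)
  set Φ : (ℝ ∙ e)ᗮ → E d := fun z => (z : E d) + h z • e
  have hΦ : ∀ y ∈ t, Φ (P y) = y := fun y hy => eq_graph_of_graphFun_eq_zero he (hG0 y hy)
  have hΦL : LipschitzWith (1 + K) Φ := lipschitzWith_graph he hh
  have hvol : (μHE[d - 1] : Measure (ℝ ∙ e)ᗮ) = volume := by
    rw [← finrank_orthogonal_span_unit he]
    exact InnerProductSpace.euclideanHausdorffMeasure_eq_volume
  have hle : ∀ s, (μHE[d - 1] : Measure (E d)) (Φ '' s)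
      ≤ ((1 + K : ℝ≥0) : ℝ≥0∞) ^ ((d - 1 : ℕ) : ℝ) * volume s := fun s => by
    rw [← hvol]; exact hΦL.euclideanHausdorffMeasure_image_le (d - 1) s
  have hnull : ∀ᵐ y ∂((μHE[d - 1] : Measure (E d)).restrict t), DifferentiableAt ℝ h (P y) := by
    rw [ae_restrict_iff' htm, ae_iff]
    refine measure_mono_null (t := Φ '' {z | ¬ DifferentiableAt ℝ h z}) ?_ ?_
    · intro y hy
      simp only [mem_ofPred_eq, Classical.not_imp] at hy
      exact ⟨P y, hy.2, hΦ y hy.1⟩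
    · have hz : (volume : Measure (ℝ ∙ e)ᗮ) {z | ¬ DifferentiableAt ℝ h z} = 0 :=
        ae_iff.1 hh.ae_differentiableAt
      have := hle {z | ¬ DifferentiableAt ℝ h z}
      rwa [hz, mul_zero, nonpos_iff_eq_zero] at this
  have hnormal : ∀ᵐ y ∂((μHE[d - 1] : Measure (E d)).restrict t),
      IsOutwardUnitNormal Ω y (‖gradient G y‖⁻¹ • gradient G y) := by
    filter_upwards [hnull, ae_restrict_mem htm] with y hy hyt
    have hGd : DifferentiableAt ℝ G y := graphFun_differentiableAt hy
    exact isOutwardUnitNormal_of_hasGradientAt hGd.hasGradientAt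
      (gradient_graphFun_ne_zero he hGd) (hG0 y hyt) (hball y hyt.2)
  refine ⟨t, inter_mem self_mem_nhdsWithin
    (mem_nhdsWithin_of_mem_nhds (Metric.ball_mem_nhds x hr)), ?_, ?_, ?_⟩
  · have hsub : t ⊆ Φ '' Metric.closedBall (P x) r := fun y hy => by
      refine ⟨P y, ?_, hΦ y hy⟩
      have := (ℝ ∙ e)ᗮ.lipschitzWith_orthogonalProjectionOnto.dist_le_mul y x
      rw [NNReal.coe_one, one_mul] at this
      exact this.trans (Metric.mem_ball.1 hy.2).le
    refine ((measure_mono hsub).trans_lt ((hle _).trans_lt (ENNReal.mul_lt_top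
      (ENNReal.rpow_lt_top_of_nonneg (by positivity) ENNReal.coe_ne_top)
      measure_closedBall_lt_top))).ne
  -- `fderiv` of an arbitrary function is Borel measurable, so the formula for the normal in terms
  -- of the gradient of `G` is a Borel version of `outwardNormal Ω` on this piece
  · have hgm : Measurable (gradient G) :=
      (InnerProductSpace.toDual ℝ (E d)).symm.continuous.measurable.comp (measurable_fderiv ℝ G)
    refine ⟨fun y => ‖gradient G y‖⁻¹ • gradient G y, hgm.norm.inv.smul hgm, ?_⟩
    filter_upwards [hnormal] with y hy using hy.outwardNormal_eq
  · filter_upwards [hnormal] with y hy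
    rw [hy.outwardNormal_eq]; exact hy.1

/-- The boundary of a bounded Lipschitz domain has finite surface measure, and its normal field is
measurable and of unit length almost everywhere: in particular the junk value `0` of
`outwardNormal` occurs only on a null set. -/
theorem surfaceMeasure_frontier {d : ℕ} {Ω : Set (E d)} (hΩ : HasLipschitzBoundary Ω)
    (hb : Bornology.IsBounded Ω) :
    IsFiniteMeasure (surfaceMeasure (frontier Ω)) ∧
      AEMeasurable (outwardNormal Ω) (surfaceMeasure (frontier Ω)) ∧
      ∀ᵐ y ∂(surfaceMeasure (frontier Ω)), ‖outwardNormal Ω y‖ = 1 := by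
  have hc : IsCompact (frontier Ω) := hb.isCompact_closure.of_isClosed_subset isClosed_frontier
    frontier_subset_closure
  have := hc.induction_on (p := fun t => (μHE[d - 1] : Measure (E d)) t ≠ ⊤ ∧
      AEMeasurable (outwardNormal Ω) ((μHE[d - 1] : Measure (E d)).restrict t) ∧
      ∀ᵐ y ∂((μHE[d - 1] : Measure (E d)).restrict t), ‖outwardNormal Ω y‖ = 1)
    (by simp) ?_ ?_ (fun x hx => exists_mem_nhdsWithin_frontier hΩ hx)
  · exact ⟨⟨by simpa [surfaceMeasure] using this.1.lt_top⟩, this.2⟩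
  · intro s t hst ⟨h1, h2, h3⟩
    exact ⟨ne_top_of_le_ne_top h1 (measure_mono hst), h2.mono_set hst,
      ae_restrict_of_ae_restrict_of_subset hst h3⟩
  · intro s t ⟨h1, h2, h3⟩ ⟨h1', h2', h3'⟩
    exact ⟨measure_union_ne_top h1 h1', aemeasurable_union_iff.2 ⟨h2, h2'⟩,
      ae_restrict_union_iff _ _ _ |>.2 ⟨h3, h3'⟩⟩

/-! ### Smooth fields as Sobolev fields, and the energy argument -/

/-- A smooth compactly supported field, as an element of `H^1(D; ℝ^d)`. -/
noncomputable def SobolevH1.ofSmooth {d : ℕ} (D : Set (E d)) (u : E d → E d) (hu : ContDiff ℝ ∞ u)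
    (hs : HasCompactSupport u) : SobolevH1 D where
  toFun := u
  grad i := partialDeriv i u
  memLp := (hu.continuous.memLp_of_hasCompactSupport hs).restrict D
  memLp_grad i := by
    have hc : Continuous (partialDeriv i u) :=
      (hu.continuous_fderiv (by simp)).clm_apply continuous_const
    have hcs : HasCompactSupport (partialDeriv i u) := hs.fderiv_apply ℝ _
    exact (hc.memLp_of_hasCompactSupport hcs).restrict D
  hasWeakPartialDeriv i := by
    intro ψ hψ hψs hψD
    set v : E d := EuclideanSpace.single i (1 : ℝ)
    have hψ' : Continuous fun x => fderiv ℝ ψ x v :=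
      (hψ.continuous_fderiv (by simp)).clm_apply continuous_const
    have hu' : Continuous fun x => fderiv ℝ u x v :=
      (hu.continuous_fderiv (by simp)).clm_apply continuous_const
    have hψ's : HasCompactSupport fun x => fderiv ℝ ψ x v := hψs.fderiv_apply ℝ v
    have h0 : ∀ x, x ∉ D → ψ x = 0 := fun x hx => image_eq_zero_of_notMem_tsupport
      fun h => hx (hψD h)
    have h0' : ∀ x, x ∉ D → fderiv ℝ ψ x v = 0 := fun x hx => by
      rw [fderiv_of_notMem_tsupport (𝕜 := ℝ) fun h => hx (hψD h)]; rfl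
    -- both integrands vanish off `D`, so that this is integration by parts on the whole space
    rw [setIntegral_eq_integral_of_forall_compl_eq_zero (fun x hx => by rw [h0' x hx, zero_smul]),
      setIntegral_eq_integral_of_forall_compl_eq_zero (fun x hx => by rw [h0 x hx, zero_smul]),
      eq_neg_iff_add_eq_zero, add_comm, ← eq_neg_iff_add_eq_zero]
    exact integral_smul_fderiv_eq_neg_fderiv_smul_of_integrable
      ((hψ'.smul hu.continuous).integrable_of_hasCompactSupport hψ's.smul_right)
      ((hψ.continuous.smul hu').integrable_of_hasCompactSupport hψs.smul_right)
      ((hψ.continuous.smul hu.continuous).integrable_of_hasCompactSupport hψs.smul_right)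
      (fun x _ => (hψ.differentiable (by simp)).differentiableAt)
      (fun x _ => (hu.differentiable (by simp)).differentiableAt)

theorem SobolevH1.hasTrace_ofSmooth {d : ℕ} {D S : Set (E d)} {u g : E d → E d}
    (hu : ContDiff ℝ ∞ u) (hs : HasCompactSupport u) (hg : MemLp g 2 (surfaceMeasure S))
    (hug : u =ᵐ[surfaceMeasure S] g) :
    HasTrace (SobolevH1.ofSmooth D u hu hs) S g := by
  refine ⟨hg, fun _ => u, fun _ => hu, ?_, fun i => ?_, ?_⟩
  · simp [SobolevH1.ofSmooth]
  · simp [SobolevH1.ofSmooth]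
  · have : eLpNorm (u - g) 2 (surfaceMeasure S) = 0 := by
      rw [eLpNorm_congr_ae (g := 0), eLpNorm_zero]
      filter_upwards [hug] with x hx
      simp [hx]
    simp [this]

theorem ae_eq_zero_of_integral_inner_self_eq_zero {X F : Type*} [MeasurableSpace X] {μ : Measure X}
    [NormedAddCommGroup F] [InnerProductSpace ℝ F] {f : X → F} (hf : MemLp f 2 μ)
    (h : ∫ x, ⟪f x, f x⟫_ℝ ∂μ = 0) : f =ᵐ[μ] 0 := by
  have hi : Integrable (fun x => ⟪f x, f x⟫_ℝ) μ := by
    simpa only [real_inner_self_eq_norm_sq] using hf.integrable_norm_pow (by norm_num)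
  filter_upwards [(integral_eq_zero_iff_of_nonneg (fun x => real_inner_self_nonneg) hi).1 h]
    with x hx using inner_self_eq_zero.1 hx

/-- The energy argument: testing the weak problem with the solution `w` itself shows that `w` has
vanishing gradient and vanishing trace as soon as the right-hand side does not act on `w`. -/
theorem IsWeakSolution.eq_zero {d : ℕ} {F : Set (E d) → E d → ℝ} {B Ω : Set (E d)} {ε : ℝ}
    (hε : 0 < ε) {w : SobolevH1 (Ω \ closure B)} {tw : E d → E d}
    (hw : IsWeakSolution F B Ω ε w tw)
    (h0 : ∫ x, F (frontier Ω) x * ⟪outwardNormal Ω x, tw x⟫_ℝ ∂(surfaceMeasure (frontier Ω)) = 0) :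
    tw =ᵐ[surfaceMeasure (frontier Ω)] 0 ∧
      ∀ i, w.grad i =ᵐ[volume.restrict (Ω \ closure B)] 0 := by
  have key := hw.2.2 w tw hw.1 hw.2.1
  rw [h0] at key
  have hint : ∀ i ∈ Finset.univ, Integrable (fun x => ⟪w.grad i x, w.grad i x⟫_ℝ)
      (volume.restrict (Ω \ closure B)) := fun i _ => by
    simpa only [real_inner_self_eq_norm_sq] using (w.memLp_grad i).integrable_norm_pow (by norm_num)
  rw [integral_finsetSum _ hint] at key
  have hnn : ∀ i ∈ Finset.univ, 0 ≤ ∫ x in Ω \ closure B, ⟪w.grad i x, w.grad i x⟫_ℝ :=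
    fun i _ => integral_nonneg fun x => real_inner_self_nonneg
  have h1 : 0 ≤ ∫ x, ⟪tw x, tw x⟫_ℝ ∂(surfaceMeasure (frontier Ω)) :=
    integral_nonneg fun x => real_inner_self_nonneg
  have h2 := mul_nonneg hε.le (Finset.sum_nonneg hnn)
  refine ⟨ae_eq_zero_of_integral_inner_self_eq_zero hw.2.1.1 (by linarith), fun i => ?_⟩
  have h3 : ∑ i, ∫ x in Ω \ closure B, ⟪w.grad i x, w.grad i x⟫_ℝ = 0 := by
    have : ε * ∑ i, ∫ x in Ω \ closure B, ⟪w.grad i x, w.grad i x⟫_ℝ = 0 := by linarith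
    exact (mul_eq_zero.1 this).resolve_left hε.ne'
  exact ae_eq_zero_of_integral_inner_self_eq_zero (w.memLp_grad i)
    ((Finset.sum_eq_zero_iff_of_nonneg hnn).1 h3 i (Finset.mem_univ i))

/-! ### The equivalence of the stationarity conditions -/

/-- The fields `g • v`, with `v` a fixed vector and `g` a smooth function with compact support away
from `closure B`, are admissible in the weak problem and determine `f` on `Γ`. -/
theorem ae_eq_zero_of_integral_normal_eq_zero {d : ℕ} {B Ω : Set (E d)}
    (hΩ : IsOpen Ω) (hb : Bornology.IsBounded Ω) (hΩlip : HasLipschitzBoundary Ω)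
    (hBΩ : closure B ⊆ Ω) {f : E d → ℝ} (hf : MemLp f 2 (surfaceMeasure (frontier Ω)))
    (h : ∀ (φ : SobolevH1 (Ω \ closure B)) (tφ : E d → E d),
      HasTrace φ (frontier B) 0 → HasTrace φ (frontier Ω) tφ →
        ∫ x, f x * ⟪outwardNormal Ω x, tφ x⟫_ℝ ∂(surfaceMeasure (frontier Ω)) = 0) :
    f =ᵐ[surfaceMeasure (frontier Ω)] 0 := by
  obtain ⟨hfin, hνm, hν⟩ := surfaceMeasure_frontier hΩlip hb
  set μ := surfaceMeasure (frontier Ω) with hμ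
  have hfi : Integrable f μ := hf.integrable (by norm_num)
  have hmem : ∀ᵐ x ∂μ, x ∈ (closure B)ᶜ := by
    filter_upwards [ae_restrict_mem isClosed_frontier.measurableSet] with x hx hxB
    exact hx.2 (hΩ.interior_eq.symm ▸ hBΩ hxB)
  have hint : Integrable (fun x => f x • outwardNormal Ω x) μ := by
    refine hfi.smul_of_top_left (memLp_top_of_bound hνm.aestronglyMeasurable 1 ?_)
    filter_upwards [hν] with x hx using hx.le
  have hvec : ∀ᵐ x ∂μ, x ∈ (closure B)ᶜ → f x • outwardNormal Ω x = 0 := by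
    refine isClosed_closure.isOpen_compl.ae_eq_zero_of_integral_contDiff_smul_eq_zero
      (hint.locallyIntegrable.locallyIntegrableOn _) fun g hg hgs hgB => ?_
    refine ext_inner_left ℝ fun v => ?_
    have hgint : Integrable (fun x => g x • f x • outwardNormal Ω x) μ :=
      
      hint.smul_of_top_right (hg.continuous.memLp_of_hasCompactSupport hgs)
    rw [inner_zero_right, ← integral_inner hgint v]
    have hu : ContDiff ℝ ∞ fun x => g x • v := hg.smul contDiff_const
    have hus : HasCompactSupport fun x => g x • v := hgs.smul_right
    have hzero : ∀ x ∈ closure B, g x = 0 := fun x hx =>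
      image_eq_zero_of_notMem_tsupport fun hx' => hgB hx' hx
    rw [← h (SobolevH1.ofSmooth _ _ hu hus) (fun x => g x • v) ?_ ?_]
    · congr 1 with x
      simp only [inner_smul_right, real_inner_comm v]
      ring
    · refine SobolevH1.hasTrace_ofSmooth hu hus MemLp.zero ?_
      filter_upwards [ae_restrict_mem isClosed_frontier.measurableSet] with x hx
      simp [hzero x (frontier_subset_closure hx)]
    · exact SobolevH1.hasTrace_ofSmooth hu hus (hu.continuous.memLp_of_hasCompactSupport hus)
        (ae_eq_refl _)
  filter_upwards [hvec, hmem, hν] with x hx hxB hx1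
  have hne : outwardNormal Ω x ≠ 0 := by
    intro h0; rw [h0, norm_zero] at hx1; exact zero_ne_one hx1
  exact (smul_eq_zero.1 (hx hxB)).resolve_right hne

theorem IsStationary.isStationaryRegularized {d : ℕ} {F : Set (E d) → E d → ℝ} {Ω : Set (E d)}
    (h : IsStationary F Ω) (B : Set (E d)) {ε : ℝ} (hε : 0 < ε) :
    IsStationaryRegularized F B Ω ε := by
  have hzero : ∀ t : E d → E d,
      ∫ x, F (frontier Ω) x * ⟪outwardNormal Ω x, t x⟫_ℝ ∂(surfaceMeasure (frontier Ω)) = 0 := by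
    intro t
    refine integral_eq_zero_of_ae ?_
    filter_upwards [h] with x hx
    simp [hx]
  constructor
  · have hgrad : ∀ i, partialDeriv i (0 : E d → E d) = 0 := fun i => by
      funext x; simp [partialDeriv]
    refine ⟨SobolevH1.ofSmooth _ 0 contDiff_const .zero, 0,
      SobolevH1.hasTrace_ofSmooth _ _ MemLp.zero (ae_eq_refl _),
      SobolevH1.hasTrace_ofSmooth _ _ MemLp.zero (ae_eq_refl _), fun φ tφ _ _ => ?_⟩
    rw [hzero]
    simp [SobolevH1.ofSmooth, hgrad]
  · intro w tw hw
    filter_upwards [(hw.eq_zero hε (hzero tw)).1] with x hx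
    simp [hx]

theorem IsStationaryRegularized.isStationary {d : ℕ} {F : Set (E d) → E d → ℝ} {B Ω : Set (E d)}
    (hΩ : IsOpen Ω) (hb : Bornology.IsBounded Ω) (hΩlip : HasLipschitzBoundary Ω)
    (hBΩ : closure B ⊆ Ω) (hF : MemLp (F (frontier Ω)) 2 (surfaceMeasure (frontier Ω)))
    {ε : ℝ} (hε : 0 < ε) (h : IsStationaryRegularized F B Ω ε) : IsStationary F Ω := by
  obtain ⟨⟨w, tw, hw⟩, hν⟩ := h
  obtain ⟨htw, hgrad⟩ := hw.eq_zero hε (integral_eq_zero_of_ae (by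
    filter_upwards [hν w tw hw] with x hx
    simp [real_inner_comm, hx]))
  refine ae_eq_zero_of_integral_normal_eq_zero hΩ hb hΩlip hBΩ hF fun φ tφ hφB hφΩ => ?_
  rw [← hw.2.2 φ tφ hφB hφΩ]
  have h1 : ∫ x in Ω \ closure B, ∑ i, ⟪w.grad i x, φ.grad i x⟫_ℝ = 0 := by
    refine integral_eq_zero_of_ae ?_
    filter_upwards [eventually_all.2 hgrad] with x hx
    simp [hx]
  have h2 : ∫ x, ⟪tw x, tφ x⟫_ℝ ∂(surfaceMeasure (frontier Ω)) = 0 := by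
    refine integral_eq_zero_of_ae ?_
    filter_upwards [htw] with x hx
    simp [hx]
  rw [h1, h2, mul_zero, add_zero]

end CMM

theorem mainTheorem1 {d : ℕ} (hd : 2 ≤ d)
    (B Ω : Set (CMM.E d))
    (hB : IsOpen B) (hBlip : CMM.HasLipschitzBoundary B)
    (hΩ : IsOpen Ω) (hΩbdd : Bornology.IsBounded Ω) (hΩlip : CMM.HasLipschitzBoundary Ω)
    (hBΩ : closure B ⊆ Ω)
    (F : Set (CMM.E d) → CMM.E d → ℝ)
    (hF : MemLp (F (frontier Ω)) 2 (CMM.surfaceMeasure (frontier Ω))) :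
    List.TFAE [
      CMM.IsStationary F Ω,
      ∀ ε : ℝ, 0 < ε → CMM.IsStationaryRegularized F B Ω ε,
      ∃ ε : ℝ, 0 < ε ∧ CMM.IsStationaryRegularized F B Ω ε] := by
  tfae_have 1 → 2 := fun h ε hε => h.isStationaryRegularized B hε
  tfae_have 2 → 3 := fun h => ⟨1, one_pos, h 1 one_pos⟩
  tfae_have 3 → 1 := fun ⟨_, hε, h⟩ => h.isStationary hΩ hΩbdd hΩlip hBΩ hF hε
  tfae_finish
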